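/- Let $n\ge 2$, $k,q\ge 1$ and $r\ge s\ge 1$ be integers with $\gcd(n,k-1,q)=1$. Let $P(r,n,k,s,q)$ be the Prishchepov group, that is, the group with generators $x_0,\dots,x_{n-1}$ and the $n$ defining relators $$x_{j}x_{j+q}\cdots x_{j+(r-1)q}\,\bigl(x_{j+k-1}x_{j+k-1+q}\cdots x_{j+k-1+(s-1)q}\bigr)^{-1}\qquad(0\le j<n),$$ where subscripts are taken modulo $n$. Suppose that $P(r,n,k,s,q)$ is of type $\mathfrak{Z}$, that is, $q(r-s)\equiv 2(k-1) \pmod n$. Then the following are equivalent: 1. the group $P(r,n,k,s,q)$ is trivial; 2. $|r-s|=1$ and either $k\equiv 1 \pmod n$ or $k\equiv 1+q(r-s) \pmod n$. -/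

import Mathlib

namespace Prishchepov

/-- The positive word `x_a x_{a+q} x_{a+2q} ⋯ x_{a+(m-1)q}` (in this order) in the free group on
`x_i`, `i ∈ ℤ/n`. -/
def word (n m q : ℕ) (a : ZMod n) : FreeGroup (ZMod n) :=
  ((List.range m).map fun i : ℕ => FreeGroup.of (a + (i : ZMod n) * (q : ZMod n))).prod

/-- The relator `(∏_{i<r} x_{j+iq}) (∏_{i<s} x_{j+k-1+iq})⁻¹`, subscripts modulo `n`. -/
def relator (r n k s q : ℕ) (j : ZMod n) : FreeGroup (ZMod n) :=
  word n r q j * (word n s q (j + (k : ZMod n) - 1))⁻¹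

/-- The Prishchepov group `P(r,n,k,s,q)`: generators `x_i` and one relator for each `j`, where
`i` and `j` run through the integers modulo `n`. -/
abbrev PGroup (r n k s q : ℕ) : Type :=
  PresentedGroup (Set.range (relator r n k s q))

/-- The parameters are of type Z: `q (r - s) ≡ 2 (k - 1) mod n`. -/
def IsTypeZ (r n k s q : ℕ) : Prop :=
  (q : ℤ) * ((r : ℤ) - (s : ℤ)) ≡ 2 * ((k : ℤ) - 1) [ZMOD (n : ℤ)]

end Prishchepov

namespace Prishchepov

open Matrix

/-! Both sides are false. If `r - s ≠ 1`, the abelianization is already nontrivial. If `r - s = 1`,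
type Z reads `q ≡ 2(k-1)`, and irreducibility makes `k - 1` a unit mod `n`; this excludes the
arithmetic condition. In the split extension by the shift, the words telescope and all relators
become the single relation `y ^ (s+1) = u * y ^ s * u`, with `u` the image of `k - 1`. A
representation in `GL (Fin 2) ℂ` with `y ≠ u ^ 2` then shows that the group is nontrivial. -/

theorem prod_conj_shift {Γ : Type*} [Group Γ] {n : ℕ} (c : Multiplicative (ZMod n) →* Γ) (y : Γ)
    (q m : ℕ) (a : ZMod n) :
    FreeGroup.lift (fun b : ZMod n => c (.ofAdd b) * y * (c (.ofAdd (b + q)))⁻¹) (word n m q a) =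
      c (.ofAdd a) * y ^ m * (c (.ofAdd (a + m * q)))⁻¹ := by
  induction m with
  | zero => simp [word]
  | succ m ih =>
    have hw : word n (m + 1) q a = word n m q a * FreeGroup.of (a + (m : ZMod n) * q) := by
      simp [word, List.range_succ]
    have e : a + (m : ZMod n) * q + q = a + ((m + 1 : ℕ) : ZMod n) * q := by push_cast; ring
    rw [hw, map_mul, ih, FreeGroup.lift_apply_of, e, pow_succ]
    group

/-- If `Γ` has an element `y` and a homomorphism `c` from `ℤ/n` with `y ^ r = c A * y ^ s * c A`,
where `A = k - 1`, then `x_a ↦ c a * y * (c (a + q))⁻¹` is a homomorphism on the Prishchepov group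
of type Z, nontrivial if `y ≠ c q`. It is the restriction of a homomorphism on the split extension by the shift. -/
theorem not_subsingleton_of_rep {Γ : Type*} [Group Γ] {r n k s q : ℕ}
    (c : Multiplicative (ZMod n) →* Γ) (y : Γ)
    (hZ : (r : ZMod n) * q = s * q + 2 * ((k : ZMod n) - 1))
    (hy : y ^ r = c (.ofAdd ((k : ZMod n) - 1)) * y ^ s * c (.ofAdd ((k : ZMod n) - 1)))
    (hne : y ≠ c (.ofAdd (q : ZMod n))) :
    ¬ Subsingleton (PGroup r n k s q) := by
  intro h
  set f : ZMod n → Γ := fun b => c (.ofAdd b) * y * (c (.ofAdd (b + q)))⁻¹ with hf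
  have hrel : ∀ w ∈ Set.range (relator r n k s q), FreeGroup.lift f w = 1 := by
    rintro _ ⟨j, rfl⟩
    have e : j + (r : ZMod n) * q =
        (j + (k : ZMod n) - 1 + s * q) + ((k : ZMod n) - 1) := by rw [hZ]; ring
    have e' : j + (k : ZMod n) - 1 = j + ((k : ZMod n) - 1) := by ring
    rw [relator, map_mul, map_inv, prod_conj_shift, prod_conj_shift, e, hy]
    generalize j + (k : ZMod n) - 1 + s * q = b
    rw [e', ofAdd_add, ofAdd_add, map_mul, map_mul]
    generalize c (.ofAdd ((k : ZMod n) - 1)) = u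
    group
  have h1 := congrArg (PresentedGroup.toGroup hrel)
    (Subsingleton.elim (PresentedGroup.of (0 : ZMod n) : PGroup r n k s q) 1)
  rw [PresentedGroup.toGroup.of, map_one] at h1
  simp only [hf, ofAdd_zero, map_one, one_mul, zero_add] at h1
  exact hne (mul_inv_eq_one.mp h1)

/-- Sending every generator to `1` maps the group onto `ℤ/(r-s)`, which is `ℤ` when `r = s`. -/
theorem not_subsingleton_of_sub_ne_one {r n k s q : ℕ} (hrs : s ≤ r) (h1 : r - s ≠ 1) :
    ¬ Subsingleton (PGroup r n k s q) := by
  intro h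
  set f : ZMod n → Multiplicative (ZMod (r - s)) := fun _ => .ofAdd 1 with hf
  have hw : ∀ m a, FreeGroup.lift f (word n m q a) = .ofAdd (m : ZMod (r - s)) := by
    intro m a
    simp [word, map_list_prod, hf, Function.comp_def, ← ofAdd_nsmul]
  have hrel : ∀ w ∈ Set.range (relator r n k s q), FreeGroup.lift f w = 1 := by
    rintro _ ⟨j, rfl⟩
    have e : (r : ZMod (r - s)) = s := by
      rw [← sub_eq_zero, ← Nat.cast_sub hrs, ZMod.natCast_self]
    rw [relator, map_mul, map_inv, hw, hw, e, mul_inv_cancel]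
  have h0 := congrArg (PresentedGroup.toGroup hrel)
    (Subsingleton.elim (PresentedGroup.of (0 : ZMod n) : PGroup r n k s q) 1)
  rw [PresentedGroup.toGroup.of, map_one] at h0
  have h2 : ((1 : ℕ) : ZMod (r - s)) = 0 := by
    rw [Nat.cast_one]; exact Multiplicative.ofAdd.injective h0
  exact h1 (Nat.dvd_one.mp ((ZMod.natCast_eq_zero_iff _ _).mp h2))

/-- A matrix with eigenvalues `1` and `ω ≠ 1`, where `ω ^ n = 1`, has order dividing `n`. -/
theorem pow_eq_one_of_trace_det {ω : ℂ} {n : ℕ} (hω : ω ^ n = 1) (h1 : ω ≠ 1)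
    (M : Matrix (Fin 2) (Fin 2) ℂ) (ht : M.trace = 1 + ω) (hd : M.det = ω) : M ^ n = 1 := by
  have h1' : ω - 1 ≠ 0 := sub_ne_zero.mpr h1
  -- Cayley–Hamilton.
  have hsq : M * M = (1 + ω) • M - ω • (1 : Matrix (Fin 2) (Fin 2) ℂ) := by
    rw [← ht, ← hd]
    ext i j
    fin_cases i <;> fin_cases j <;>
      simp [Matrix.mul_apply, Fin.sum_univ_two, Matrix.trace, Matrix.det_fin_two] <;> ring
  have key : ∀ m : ℕ, (ω - 1) • M ^ m =
      (ω ^ m - 1) • M - (ω ^ m - ω) • (1 : Matrix (Fin 2) (Fin 2) ℂ) := by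
    intro m
    induction m with
    | zero => rw [pow_zero, pow_zero]; module
    | succ m ih =>
      rw [pow_succ, ← smul_mul_assoc, ih, sub_mul, smul_mul_assoc, smul_mul_assoc, hsq, one_mul,
        pow_succ]
      module
  have := key n
  rw [hω, sub_self, zero_smul, zero_sub, ← neg_smul, neg_sub] at this
  exact smul_right_injective _ h1' this

/-- A non-abelian representation of the group `⟨u, y | u ^ n, y ^ (s + 1) = u y ^ s u⟩`, a central
extension of the `(2, n, 2 s + 1)` triangle group. -/
theorem exists_triangle_rep {n s : ℕ} (hn : 2 ≤ n) (hs : 1 ≤ s) :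
    ∃ U Y : GL (Fin 2) ℂ, U ^ n = 1 ∧ Y ^ (s + 1) = U * Y ^ s * U ∧ Y ≠ U ^ 2 := by
  obtain ⟨ω, hω⟩ : ∃ ω : ℂ, IsPrimitiveRoot ω n :=
    ⟨_, Complex.isPrimitiveRoot_exp n (by omega)⟩
  obtain ⟨ζ, hζ⟩ : ∃ ζ : ℂ, IsPrimitiveRoot ζ (2 * s + 1) :=
    ⟨_, Complex.isPrimitiveRoot_exp (2 * s + 1) (by omega)⟩
  have hω1 : ω ≠ 1 := hω.ne_one (by omega)
  have hω0 : ω ≠ 0 := hω.ne_zero (by omega)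
  have hζ0 : ζ ≠ 0 := hζ.ne_zero (by omega)
  have hζs : ζ ^ (2 * s) ≠ 1 := hζ.pow_ne_one_of_pos_of_lt (by omega) (by omega)
  have hζ2 : ζ ^ 2 ≠ 1 := hζ.pow_ne_one_of_pos_of_lt (by omega) (by omega)
  -- Eigenvalues of `Y`: the relation forces `det Y = ω ^ 2`, and `ζ ^ (2 * s + 1) = 1` makes `Y ^
  -- (2 * s + 1)` scalar.
  obtain ⟨a, ha⟩ : ∃ a : ℂ, a = -ω * ζ := ⟨_, rfl⟩
  obtain ⟨b, hb⟩ : ∃ b : ℂ, b = -ω * ζ⁻¹ := ⟨_, rfl⟩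
  have ha0 : a ≠ 0 := by rw [ha]; exact mul_ne_zero (neg_ne_zero.mpr hω0) hζ0
  have hb0 : b ≠ 0 := by rw [hb]; exact mul_ne_zero (neg_ne_zero.mpr hω0) (inv_ne_zero hζ0)
  have hab : a ≠ b := by
    intro h
    rw [ha, hb] at h
    apply hζ2
    have := mul_left_cancel₀ (neg_ne_zero.mpr hω0) h
    field_simp at this
    exact this
  have habs : a ^ s ≠ b ^ s := by
    intro h
    rw [ha, hb, mul_pow, mul_pow] at h
    apply hζs
    have := mul_left_cancel₀ (pow_ne_zero s (neg_ne_zero.mpr hω0)) h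
    rw [inv_pow] at this
    have h2 := (mul_eq_one_iff_eq_inv₀ (pow_ne_zero s hζ0)).mpr this
    rw [two_mul, pow_add, h2]
  have haL : a ^ (2 * s + 1) = (-ω) ^ (2 * s + 1) := by rw [ha, mul_pow, hζ.pow_eq_one, mul_one]
  have hbL : b ^ (2 * s + 1) = (-ω) ^ (2 * s + 1) := by
    rw [hb, mul_pow, inv_pow, hζ.pow_eq_one, inv_one, mul_one]
  have hprod : a ^ s * b ^ s = (-ω) ^ (2 * s) := by
    rw [← mul_pow, ha, hb, pow_mul]; congr 1; field_simp
  have hL : (-ω) ^ (2 * s + 1) = -ω * (a ^ s * b ^ s) := by rw [hprod, pow_succ]; ring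
  rw [hL] at haL hbL
  have has := pow_ne_zero s ha0
  have hbs := pow_ne_zero s hb0
  have ha1 : a ^ (s + 1) * a ^ s = -ω * (a ^ s * b ^ s) := by rw [← haL]; ring
  have hb1 : b ^ (s + 1) * b ^ s = -ω * (a ^ s * b ^ s) := by rw [← hbL]; ring
  generalize hA : a ^ s = α at *
  generalize hB : b ^ s = β at *
  have hαβ : β - α ≠ 0 := sub_ne_zero.mpr (Ne.symm habs)
  -- The relation says `(U * Y ^ s) ^ 2 = Y ^ (2 * s + 1)`, a scalar. So take `U * Y ^ s = !![p, 1;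
  -- γ, -p]`, traceless: `p` fixes the trace of `U`, and `γ` the square.
  obtain ⟨p, hp⟩ : ∃ p : ℂ, p * (β - α) = (1 + ω) * (α * β) :=
    ⟨(1 + ω) * (α * β) / (β - α), div_mul_cancel₀ _ hαβ⟩
  obtain ⟨γ, hγ⟩ : ∃ γ : ℂ, p ^ 2 + γ = -ω * (α * β) := ⟨-ω * (α * β) - p ^ 2, by ring⟩
  set M : Matrix (Fin 2) (Fin 2) ℂ := !![p / α, 1 / β; γ / α, -p / β] with hM
  set D : Matrix (Fin 2) (Fin 2) ℂ := !![a, 0; 0, b] with hD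
  have hMdet : M.det = ω := by
    rw [hM, det_fin_two_of]
    field_simp
    linear_combination -hγ
  have hMtr : M.trace = 1 + ω := by
    rw [hM, trace_fin_two_of]
    field_simp
    linear_combination hp
  have hDdet : D.det ≠ 0 := by
    rw [hD, det_fin_two_of]; simp [ha0, hb0]
  have hDpow : ∀ m : ℕ, D ^ m = !![a ^ m, 0; 0, b ^ m] := by
    intro m
    induction m with
    | zero => simp [Matrix.one_fin_two]
    | succ m ih => rw [pow_succ, ih, hD]; simp [pow_succ]
  refine ⟨GeneralLinearGroup.mkOfDetNeZero M (hMdet ▸ hω0),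
    GeneralLinearGroup.mkOfDetNeZero D hDdet, ?_, ?_, ?_⟩
  · apply Units.ext
    exact pow_eq_one_of_trace_det hω.pow_eq_one hω1 M hMtr hMdet
  · apply Units.ext
    change D ^ (s + 1) = M * D ^ s * M
    rw [hDpow, hDpow, hA, hB, hM, mul_fin_two, mul_fin_two]
    have h1 := eq_div_of_mul_eq has ha1
    have h2 := eq_div_of_mul_eq hbs hb1
    rw [h1, h2, ← hγ]
    ext i j
    fin_cases i <;> fin_cases j <;> simp <;> field_simp <;> ring
  · intro h
    have h' : D = M * M := by
      rw [← sq]; exact congrArg Units.val h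
    -- `D` is diagonal with `a ≠ b`, so it cannot commute with `M`, whose upper right entry is
    -- nonzero.
    have hc : D * M = M * D := by rw [h', mul_assoc]
    have h01 := congrFun (congrFun hc 0) 1
    simp [hD, hM, mul_apply, Fin.sum_univ_two] at h01
    apply hab
    field_simp at h01
    exact h01

theorem exists_zmod_hom {Γ : Type*} [Group Γ] {n : ℕ} {U : Γ} (hU : U ^ n = 1) {A : ZMod n}
    (hA : IsUnit A) : ∃ c : Multiplicative (ZMod n) →* Γ, c (.ofAdd A) = U := by
  obtain ⟨u, rfl⟩ := hA
  let g : ZMod n →+ Additive Γ := ZMod.lift n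
    ⟨zmultiplesHom (Additive Γ) (.ofMul U), by
      rw [zmultiplesHom_apply, natCast_zsmul, ← ofMul_pow, hU, ofMul_one]⟩
  refine ⟨AddMonoidHom.toMultiplicativeLeft (g.comp (AddMonoidHom.mulRight (↑u⁻¹ : ZMod n))), ?_⟩
  have : g 1 = .ofMul U := by
    have := ZMod.lift_coe n ⟨zmultiplesHom (Additive Γ) (.ofMul U), by
      rw [zmultiplesHom_apply, natCast_zsmul, ← ofMul_pow, hU, ofMul_one]⟩ 1
    simpa using this
  simp [this]

/-- A common divisor of `n` and `k - 1` also divides `q`, because `q ≡ 2(k-1)` mod `n`. -/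
theorem isUnit_shift {n k q : ℕ} (hk : 1 ≤ k) (hirr : Nat.gcd n (Nat.gcd (k - 1) q) = 1)
    (hq : (q : ZMod n) = 2 * ((k : ZMod n) - 1)) : IsUnit ((k : ZMod n) - 1) := by
  have e : (k : ZMod n) - 1 = ((k - 1 : ℕ) : ZMod n) := by push_cast [hk]; ring
  rw [e] at hq ⊢
  rw [ZMod.isUnit_iff_coprime, Nat.coprime_comm, Nat.Coprime, ← Nat.dvd_one]
  have h1 := Nat.gcd_dvd_left n (k - 1)
  have h2 := Nat.gcd_dvd_right n (k - 1)
  refine (Nat.dvd_gcd h1 (Nat.dvd_gcd h2 ?_)).trans hirr.dvd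
  have h3 : q ≡ 2 * (k - 1) [MOD n] := by
    rw [← ZMod.natCast_eq_natCast_iff]; push_cast; exact hq
  exact ((h3.of_dvd h1).dvd_iff dvd_rfl).mpr (h2.mul_left 2)

/-- An irreducible Prishchepov group of type Z with at least two generators is never trivial. -/
theorem not_subsingleton_of_isTypeZ {r n k s q : ℕ} (hn : 2 ≤ n) (hk : 1 ≤ k) (hs : 1 ≤ s)
    (hrs : s ≤ r) (hirr : Nat.gcd n (Nat.gcd (k - 1) q) = 1) (hZ : IsTypeZ r n k s q) :
    ¬ Subsingleton (PGroup r n k s q) := by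
  by_cases h1 : r - s = 1
  · obtain rfl : r = s + 1 := by omega
    have hq : (q : ZMod n) = 2 * ((k : ZMod n) - 1) := by
      have := (ZMod.intCast_eq_intCast_iff _ _ _).mpr hZ
      push_cast at this
      linear_combination this
    obtain ⟨U, Y, hU, hY, hne⟩ := exists_triangle_rep hn hs
    obtain ⟨c, hc⟩ := exists_zmod_hom hU (isUnit_shift hk hirr hq)
    refine not_subsingleton_of_rep c Y ?_ ?_ ?_
    · push_cast; linear_combination hq
    · rw [hc, hY]
    · rwa [hq, two_mul, ofAdd_add, map_mul, hc, ← sq]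
  · exact not_subsingleton_of_sub_ne_one hrs h1

/-- For irreducible parameters of type Z and `n ≥ 2`, the arithmetic condition for triviality
cannot be met. -/
theorem not_arith_condition {r n k s q : ℕ} (hn : 2 ≤ n) (hk : 1 ≤ k) (hrs : s ≤ r)
    (hirr : Nat.gcd n (Nat.gcd (k - 1) q) = 1) (hZ : IsTypeZ r n k s q) :
    ¬ (|(r : ℤ) - (s : ℤ)| = 1 ∧
        ((k : ℤ) ≡ 1 [ZMOD (n : ℤ)] ∨
          (k : ℤ) ≡ 1 + (q : ℤ) * ((r : ℤ) - (s : ℤ)) [ZMOD (n : ℤ)])) := by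
  rintro ⟨h1, h2⟩
  have hd : (r : ℤ) - s = 1 := by
    rwa [abs_of_nonneg (by rw [sub_nonneg]; exact_mod_cast hrs)] at h1
  rw [IsTypeZ, hd, mul_one, ← ZMod.intCast_eq_intCast_iff] at hZ
  rw [hd, mul_one, ← ZMod.intCast_eq_intCast_iff, ← ZMod.intCast_eq_intCast_iff] at h2
  push_cast at hZ h2
  -- In the second case `k - 1 = q = 2(k-1)`.
  have hk0 : (k : ZMod n) - 1 = 0 := by
    rcases h2 with h | h
    · rw [h, sub_self]
    · linear_combination -h - hZ
  have hu := isUnit_shift hk hirr hZ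
  have : Fact (1 < n) := ⟨hn⟩
  rw [hk0] at hu
  exact not_isUnit_zero hu

end Prishchepov

theorem mainTheorem5 (r n k s q : ℕ) (hn : 2 ≤ n) (hk : 1 ≤ k) (hq : 1 ≤ q) (hs : 1 ≤ s)
    (hrs : s ≤ r) (hirr : Nat.gcd n (Nat.gcd (k - 1) q) = 1)
    (hZ : Prishchepov.IsTypeZ r n k s q) :
    Subsingleton (Prishchepov.PGroup r n k s q) ↔
      |(r : ℤ) - (s : ℤ)| = 1 ∧
        ((k : ℤ) ≡ 1 [ZMOD (n : ℤ)] ∨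
          (k : ℤ) ≡ 1 + (q : ℤ) * ((r : ℤ) - (s : ℤ)) [ZMOD (n : ℤ)]) := by
  exact iff_of_false (Prishchepov.not_subsingleton_of_isTypeZ hn hk hs hrs hirr hZ)
    (Prishchepov.not_arith_condition hn hk hrs hirr hZ)
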